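/- Let $A\in M_n(\mathbb Z)$ be non-singular with characteristic polynomial $h_A=\det(xI-A)\in\mathbb Z[x]$, and let $$G_A=\{A^k\mathbf x \mid \mathbf x\in\mathbb Z^n,\ k\in\mathbb Z\}\subseteq\mathbb Q^n,$$ a subgroup of $\mathbb Q^n$. Let $\operatorname{End}(G_A)$ be the ring of all group endomorphisms of $G_A$ (with composition as multiplication) and $\operatorname{Aut}(G_A)$ its group of units. Every $T\in\operatorname{End}(G_A)$ is given by multiplication by a unique matrix in $M_n(\mathbb Q)$, again denoted $T$. For a prime $p$ let $t_p$ be the multiplicity of $0$ as a root of the reduction of $h_A$ modulo $p$, and let $\mathcal P'$ be the set of primes $p$ dividing $\det A$ such that $h_A\not\equiv x^n \pmod p$. Assume that $h_A$ is irreducible in $\mathbb Z[x]$, that $\mathcal P'\neq\emptyset$, and that there is a prime $p$ with $\gcd(n,t_p)=1$. Let $\lambda$ be an eigenvalue of $A$, let $K=\mathbb Q(\lambda)$ with ring of integers $\mathcal O_K$, and let $\mathcal S_\lambda$ be the set of non-zero prime ideals of $\mathcal O_K$ dividing $\lambda$. Then there is an injective (unital) ring homomorphism $$\imath:\operatorname{End}(G_A)\hookrightarrow\mathcal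 O_K[\lambda^{-1}]$$ such that for every eigenvector $\mathbf u\in K^n$ of $A$ with eigenvalue $\lambda$ and every $T\in\operatorname{End}(G_A)$ one has $T\mathbf u=\imath(T)\,\mathbf u$, and $T(K\mathbf u)=K\mathbf u$ if $T\neq0$. Moreover, $\imath$ restricts to an injective group homomorphism from $\operatorname{Aut}(G_A)$ to the group of $\mathcal S_\lambda$-units $$\{x\in K^\times \mid \operatorname{val}_{\mathfrak p}(x)=0 \text{ for every non-zero prime ideal } \mathfrak p\notin\mathcal S_\lambda \text{ of } \mathcal O_K\}.$$ -/

import Mathlib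

open Polynomial IntermediateField NumberField IsDedekindDomain

/-- An integer matrix viewed as a rational matrix. -/
abbrev ratMat {n : ℕ} (A : Matrix (Fin n) (Fin n) ℤ) : Matrix (Fin n) (Fin n) ℚ :=
  A.map (Int.castRingHom ℚ)

theorem isUnit_det_ratMat {n : ℕ} {A : Matrix (Fin n) (Fin n) ℤ} (hA : A.det ≠ 0) :
    IsUnit (ratMat A).det := by
  have h : (ratMat A).det = ((A.det : ℤ) : ℚ) :=
    ((Int.castRingHom ℚ).map_det A).symm
  rw [h, isUnit_iff_ne_zero]
  exact_mod_cast hA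

/-- Lowering the exponent: `A ^ k x = A ^ m y` for some integer vector `y` when `m ≤ k`. -/
theorem exists_zpow_mulVec_eq {n : ℕ} {A : Matrix (Fin n) (Fin n) ℤ} (hA : A.det ≠ 0)
    {k m : ℤ} (h : m ≤ k) (x : Fin n → ℤ) :
    ∃ y : Fin n → ℤ, (ratMat A ^ k).mulVec (fun i => (x i : ℚ)) =
      (ratMat A ^ m).mulVec (fun i => (y i : ℚ)) := by
  obtain ⟨d, rfl⟩ : ∃ d : ℕ, k = m + d := ⟨(k - m).toNat, by omega⟩
  refine ⟨(A ^ d).mulVec x, ?_⟩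
  have h1 : (fun i => (((A ^ d).mulVec x i : ℤ) : ℚ)) =
      (ratMat A ^ d).mulVec (fun i => (x i : ℚ)) := by
    have hp : ratMat A ^ d = (A ^ d).map (Int.castRingHom ℚ) :=
      (Matrix.map_pow A (Int.castRingHom ℚ) d).symm
    rw [hp]
    funext i
    simp [Matrix.mulVec, dotProduct]
  rw [h1, Matrix.mulVec_mulVec, Matrix.zpow_add (isUnit_det_ratMat hA), zpow_natCast]

/-- The group `G_A = {A ^ k x | x ∈ ℤ ^ n, k ∈ ℤ} ⊆ ℚ ^ n` of a non-singular integer matrix `A`. -/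
def groupG {n : ℕ} (A : Matrix (Fin n) (Fin n) ℤ) (hA : A.det ≠ 0) :
    AddSubgroup (Fin n → ℚ) where
  carrier := {v | ∃ (k : ℤ) (x : Fin n → ℤ),
    v = (ratMat A ^ k).mulVec (fun i => (x i : ℚ))}
  zero_mem' := ⟨0, 0, by funext i; simp⟩
  add_mem' := by
    rintro _ _ ⟨k, x, rfl⟩ ⟨l, y, rfl⟩
    obtain ⟨x', hx⟩ := exists_zpow_mulVec_eq hA (min_le_left k l) x
    obtain ⟨y', hy⟩ := exists_zpow_mulVec_eq hA (min_le_right k l) y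
    refine ⟨min k l, x' + y', ?_⟩
    rw [hx, hy, ← Matrix.mulVec_add]
    congr 1
    funext i
    simp
  neg_mem' := by
    rintro _ ⟨k, x, rfl⟩
    refine ⟨k, -x, ?_⟩
    rw [← Matrix.mulVec_neg]
    congr 1

theorem intVec_mem_groupG {n : ℕ} (A : Matrix (Fin n) (Fin n) ℤ) (hA : A.det ≠ 0)
    (x : Fin n → ℤ) : (fun i => (x i : ℚ)) ∈ groupG A hA :=
  ⟨0, x, by simp⟩

theorem single_mem_groupG {n : ℕ} (A : Matrix (Fin n) (Fin n) ℤ) (hA : A.det ≠ 0)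
    (j : Fin n) : (Pi.single j 1 : Fin n → ℚ) ∈ groupG A hA := by
  have h := intVec_mem_groupG A hA (Pi.single j 1)
  convert h using 1
  funext i
  by_cases hij : i = j
  · subst hij; simp
  · simp [hij]

/-- The endomorphism ring of `G_A`: all group homomorphisms `G_A → G_A`, multiplied by
composition. -/
abbrev EndG {n : ℕ} (A : Matrix (Fin n) (Fin n) ℤ) (hA : A.det ≠ 0) : Type :=
  AddMonoid.End (groupG A hA)

/-- The automorphism group of `G_A`: the invertible endomorphisms, under composition. -/
abbrev AutG {n : ℕ} (A : Matrix (Fin n) (Fin n) ℤ) (hA : A.det ≠ 0) : Type :=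
  (EndG A hA)ˣ

/-- The rational matrix of an endomorphism `T` of `G_A`: its `j`-th column is `T e_j`. -/
def endMatrix {n : ℕ} {A : Matrix (Fin n) (Fin n) ℤ} {hA : A.det ≠ 0}
    (T : EndG A hA) : Matrix (Fin n) (Fin n) ℚ :=
  Matrix.of fun i j => (T ⟨Pi.single j 1, single_mem_groupG A hA j⟩ : Fin n → ℚ) i

/-- The matrix `endMatrix T` induces `T` on all of `G_A`. -/
theorem endMatrix_mulVec {n : ℕ} {A : Matrix (Fin n) (Fin n) ℤ} {hA : A.det ≠ 0}
    (T : EndG A hA) (g : groupG A hA) :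
    (endMatrix T).mulVec (g : Fin n → ℚ) = (T g : Fin n → ℚ) := by
  obtain ⟨N, hN⟩ := IsLocalization.exist_integer_multiples_of_finite
    (nonZeroDivisors ℤ) (g : Fin n → ℚ)
  choose z hz using hN
  have hN0 : ((N : ℤ) : ℚ) ≠ 0 := by
    exact_mod_cast nonZeroDivisors.coe_ne_zero N
  have hg : (N : ℤ) • g = ∑ j, z j •
      (⟨Pi.single j 1, single_mem_groupG A hA j⟩ : groupG A hA) := by
    apply Subtype.ext
    funext i
    have := hz i
    simp [Finset.sum_apply, Pi.single_apply] at this ⊢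
    exact this.symm
  have hT : (N : ℤ) • T g = ∑ j, z j •
      T (⟨Pi.single j 1, single_mem_groupG A hA j⟩ : groupG A hA) := by
    rw [← map_zsmul, hg, map_sum]
    simp only [map_zsmul]
  funext i
  have hTi := congrArg (fun w : groupG A hA => (w : Fin n → ℚ) i) hT
  simp [Finset.sum_apply] at hTi
  apply mul_left_cancel₀ hN0
  rw [hTi]
  simp only [endMatrix, Matrix.mulVec, dotProduct, Matrix.of_apply, Finset.mul_sum]
  refine Finset.sum_congr rfl fun j _ => ?_
  have := hz j
  simp at this
  rw [this]
  ring

/-- `𝒫(A)`: the primes dividing `det A`. -/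
def primesP {n : ℕ} (A : Matrix (Fin n) (Fin n) ℤ) : Set ℕ :=
  {p | p.Prime ∧ (p : ℤ) ∣ A.det}

/-- `𝒫'(A)`: the primes `p ∈ 𝒫(A)` such that `h_A` is not congruent to `x ^ n` modulo `p`. -/
def primesP' {n : ℕ} (A : Matrix (Fin n) (Fin n) ℤ) : Set ℕ :=
  {p | p ∈ primesP A ∧ A.charpoly.map (Int.castRingHom (ZMod p)) ≠ X ^ n}

/-- `t_p`: the multiplicity of zero as a root of the reduction of `h_A` modulo `p`. -/
noncomputable def tMult {n : ℕ} (A : Matrix (Fin n) (Fin n) ℤ) (p : ℕ) : ℕ :=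
  (A.charpoly.map (Int.castRingHom (ZMod p))).rootMultiplicity 0

/-- `𝒪_{K,λ} = 𝒪_K[λ⁻¹]`, for an element `λ` of a number field `K`. -/
noncomputable def ringOKl (K : Type*) [Field K] [NumberField K] (l : K) : Subalgebra (𝓞 K) K :=
  Algebra.adjoin (𝓞 K) {l⁻¹}

/-- `𝒮_λ`: the non-zero prime ideals of `𝒪_K` dividing (that is, containing) the algebraic
integer `λ` of the number field `K`. -/
def primesDividing (K : Type*) [Field K] [NumberField K] (l : K) :
    Set (HeightOneSpectrum (𝓞 K)) :=
  {v | ∃ a : 𝓞 K, (a : K) = l ∧ a ∈ v.asIdeal}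

/-! Let `L` be a Galois number field containing `K`, and for each embedding `φ : K → L` let `u_φ`,
`w_φ` be the conjugates of a right and a left eigenvector of `A` for `λ`. The `φ(λ)` are `n`
distinct numbers, so the `u_φ` form a basis and the `w_φ` are dual to it up to scaling. Hence `u` is
an eigenvector of `T` as soon as `w_ψ · T u_φ = 0` for all `ψ ≠ φ`.

Fix a prime `v` of `L` above `p`. If `ψ(λ)` is a `v`-unit, then `w_ψ` is `v`-bounded on `G_A`. If
`v(φ(λ)) < 1`, writing `u_φ = φ(λ)^k A^{-k} u_φ` and using `T G_A ⊆ G_A` makes `w_ψ · T u_φ`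
arbitrarily small, hence zero (`dotProduct_endMatrix_mulVec_eq_zero`). Exactly `t_p` of the `n`
embeddings have `v(φ(λ)) < 1`, and the Galois group acts transitively on embeddings. As `gcd(n, t_p)
= 1`, any ordered pair `φ ≠ ψ` can be moved into this position (`exists_smul_mem_smul_notMem`), and
since `T` is rational the vanishing descends to `(φ, ψ)`.

The map `ι` sends `T` to its eigenvalue at `u`. It is injective because the conjugates of `u` span,
and its values lie in `𝒪_K[λ⁻¹]` because some `A^m T` is integral. -/

/-! ### Separating points by translates of a set -/

/-- In a transitive action on a finite set, translates of a subset whose cardinality is coprime to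
that of the whole set separate points. -/
theorem exists_smul_mem_smul_notMem {G X : Type*} [Group G] [MulAction G X] [Fintype X]
    [DecidableEq X] [MulAction.IsPretransitive G X] (S : Finset X)
    (hS : Nat.Coprime (Fintype.card X) S.card) {x y : X} (hxy : x ≠ y) :
    ∃ g : G, g • x ∈ S ∧ g • y ∉ S := by
  classical
  by_contra! hcon
  -- `B x` collects the points that no translate of `S` separates from `x`. This is a preorder; by
  -- transitivity all `B x` are equinumerous, so it is an equivalence relation. Both `X` and `S` are
  -- unions of classes, so the class size divides both cardinalities.
  let B : X → Finset X := fun x => Finset.univ.filter fun y => ∀ g : G, g • x ∈ S → g • y ∈ S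
  have hB : ∀ {x y}, y ∈ B x ↔ ∀ g : G, g • x ∈ S → g • y ∈ S := by simp [B]
  have hself : ∀ x, x ∈ B x := fun x => hB.2 fun _ h => h
  have hsub : ∀ {x y}, y ∈ B x → B y ⊆ B x := fun h z hz =>
    hB.2 fun g hg => hB.1 hz g (hB.1 h g hg)
  have hle : ∀ x y, (B x).card ≤ (B y).card := fun x y => by
    obtain ⟨g, rfl⟩ := MulAction.exists_smul_eq G x y
    refine Finset.card_le_card_of_injOn (g • ·) (fun z hz => hB.2 fun g' hg' => ?_)
      (MulAction.injective g).injOn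
    have := hB.1 hz (g' * g)
    simp only [mul_smul] at this
    exact this hg'
  have heq : ∀ {x y}, y ∈ B x → B y = B x := fun h =>
    Finset.eq_of_subset_of_card_le (hsub h) (hle _ _)
  have hdvd : ∀ Y : Finset X, (∀ z ∈ Y, B z ⊆ Y) → (B x).card ∣ Y.card := fun Y hY => by
    rw [Finset.card_eq_sum_card_image B Y]
    refine Finset.dvd_sum fun b hb => ?_
    obtain ⟨z, hz, rfl⟩ := Finset.mem_image.1 hb
    have : Y.filter (fun a => B a = B z) = B z := by
      ext a
      rw [Finset.mem_filter]
      exact ⟨fun h => h.2 ▸ hself a, fun h => ⟨hY z hz h, heq h⟩⟩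
    rw [this, (hle z x).antisymm (hle x z)]
  have h1 : (B x).card ∣ Fintype.card X := hdvd Finset.univ fun z _ => Finset.subset_univ _
  have h2 : (B x).card ∣ S.card := hdvd S fun z hz a ha => by
    simpa using hB.1 ha 1 (by simpa using hz)
  have h3 : (B x).card = 1 := Nat.eq_one_of_dvd_coprimes hS h1 h2
  exact hxy (Finset.card_le_one.1 h3.le x (hself x) y (hB.2 hcon))

/-! ### Eigenvectors and valuations on `G_A` -/

theorem map_intCast_le_one_of_valuation {L Γ : Type*} [Field L]
    [LinearOrderedCommGroupWithZero Γ] (v : Valuation L Γ) (z : ℤ) : v z ≤ 1 :=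
  (intCast_mem v.valuationSubring z : (z : L) ∈ v.valuationSubring)

theorem Matrix.pow_mulVec_of_mulVec_eq_smul {L m : Type*} [Field L] [Fintype m] [DecidableEq m]
    {M : Matrix m m L} {u : m → L} {a : L} (h : M.mulVec u = a • u) (k : ℕ) :
    (M ^ k).mulVec u = a ^ k • u := by
  induction k with
  | zero => simp
  | succ k ih => rw [pow_succ, ← Matrix.mulVec_mulVec, h, Matrix.mulVec_smul, ih, smul_smul,
      pow_succ']

theorem Matrix.mulVec_of_mul_eq_one {L m : Type*} [Field L] [Fintype m] [DecidableEq m]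
    {M N : Matrix m m L} (hNM : N * M = 1) {u : m → L} {a : L} (ha : a ≠ 0)
    (h : M.mulVec u = a • u) : N.mulVec u = a⁻¹ • u := by
  have : N.mulVec (M.mulVec u) = u := by rw [Matrix.mulVec_mulVec, hNM, Matrix.one_mulVec]
  rw [h, Matrix.mulVec_smul] at this
  rw [← this, smul_smul, inv_mul_cancel₀ ha, one_smul, this]

/-- Eigenvectors of a rational matrix over a larger field are eigenvectors of its integer powers. -/
theorem Matrix.map_zpow_mulVec {L m : Type*} [Field L] [Algebra ℚ L] [Fintype m] [DecidableEq m]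
    {M : Matrix m m ℚ} (hM : IsUnit M.det) {u : m → L} {a : L} (ha : a ≠ 0)
    (h : (M.map (algebraMap ℚ L)).mulVec u = a • u) (k : ℤ) :
    ((M ^ k).map (algebraMap ℚ L)).mulVec u = a ^ k • u := by
  have hinv : ((M⁻¹).map (algebraMap ℚ L)).mulVec u = a⁻¹ • u := by
    refine Matrix.mulVec_of_mul_eq_one ?_ ha h
    rw [← Matrix.map_mul, Matrix.nonsing_inv_mul _ hM]
    simp
  obtain ⟨k, rfl | rfl⟩ := k.eq_nat_or_neg
  · rw [zpow_natCast, zpow_natCast, Matrix.map_pow]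
    exact Matrix.pow_mulVec_of_mulVec_eq_smul h k
  · rw [Matrix.zpow_neg_natCast, _root_.zpow_neg, zpow_natCast, ← inv_pow, ← Matrix.inv_pow',
      Matrix.map_pow]
    exact Matrix.pow_mulVec_of_mulVec_eq_smul hinv k

theorem Matrix.vecMul_map_zpow {L m : Type*} [Field L] [Algebra ℚ L] [Fintype m] [DecidableEq m]
    {M : Matrix m m ℚ} (hM : IsUnit M.det) {w : m → L} {b : L} (hb : b ≠ 0)
    (h : Matrix.vecMul w (M.map (algebraMap ℚ L)) = b • w) (k : ℤ) :
    Matrix.vecMul w ((M ^ k).map (algebraMap ℚ L)) = b ^ k • w := by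
  rw [← Matrix.mulVec_transpose, ← Matrix.transpose_map, Matrix.transpose_zpow]
  refine Matrix.map_zpow_mulVec (by rwa [Matrix.det_transpose]) hb ?_ k
  rw [Matrix.transpose_map, Matrix.mulVec_transpose, h]

/-- A left eigenvector whose eigenvalue is a unit is bounded on `G_A`. -/
theorem valuation_dotProduct_le_of_mem_groupG {n : ℕ} {A : Matrix (Fin n) (Fin n) ℤ}
    {hA : A.det ≠ 0} {L Γ : Type*} [Field L] [Algebra ℚ L] [LinearOrderedCommGroupWithZero Γ]
    (v : Valuation L Γ) {w : Fin n → L} {b : L} (hb : v b = 1)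
    (hw : Matrix.vecMul w ((ratMat A).map (algebraMap ℚ L)) = b • w) {C : Γ}
    (hC : ∀ i, v (w i) ≤ C) {g : Fin n → ℚ} (hg : g ∈ groupG A hA) :
    v (w ⬝ᵥ (algebraMap ℚ L ∘ g)) ≤ C := by
  obtain ⟨k, x, rfl⟩ := hg
  have hb0 : b ≠ 0 := by rintro rfl; simp at hb
  have h1 : algebraMap ℚ L ∘ ((ratMat A ^ k).mulVec fun i => (x i : ℚ)) =
      ((ratMat A ^ k).map (algebraMap ℚ L)).mulVec fun i => (x i : L) := by
    funext i
    rw [Function.comp_apply, RingHom.map_mulVec]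
    exact congrFun (congrArg _ (_root_.funext fun j => by simp)) i
  rw [h1, Matrix.dotProduct_mulVec, Matrix.vecMul_map_zpow (isUnit_det_ratMat hA) hb0 hw,
    smul_dotProduct, smul_eq_mul, map_mul, map_zpow₀, hb, one_zpow, one_mul]
  refine v.map_sum_le fun i _ => ?_
  rw [map_mul]
  exact (mul_le_mul' (hC i) (map_intCast_le_one_of_valuation v _)).trans_eq (mul_one C)

/-- An endomorphism of `G_A` pairs to zero a right eigenvector whose eigenvalue is topologically
nilpotent with a left eigenvector whose eigenvalue is a unit. -/
theorem dotProduct_endMatrix_mulVec_eq_zero {n : ℕ} {A : Matrix (Fin n) (Fin n) ℤ}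
    {hA : A.det ≠ 0} {L Γ : Type*} [Field L] [Algebra ℚ L] [LinearOrderedCommGroupWithZero Γ]
    [MulArchimedean Γ] (v : Valuation L Γ) {u w : Fin n → L} {a b : L} (ha0 : a ≠ 0)
    (ha : v a < 1) (hb : v b = 1)
    (hu : ((ratMat A).map (algebraMap ℚ L)).mulVec u = a • u)
    (hw : Matrix.vecMul w ((ratMat A).map (algebraMap ℚ L)) = b • w) (T : EndG A hA) :
    w ⬝ᵥ ((endMatrix T).map (algebraMap ℚ L)).mulVec u = 0 := by
  obtain ⟨C, hC⟩ : ∃ C : Γ, ∀ i, v (w i) ≤ C :=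
    (Set.finite_range fun i => v (w i)).bddAbove.imp fun C hC i => hC ⟨i, rfl⟩
  obtain ⟨D, hD⟩ : ∃ D : Γ, ∀ i, v (u i) ≤ D :=
    (Set.finite_range fun i => v (u i)).bddAbove.imp fun C hC i => hC ⟨i, rfl⟩
  have key : ∀ k : ℕ, v (w ⬝ᵥ ((endMatrix T).map (algebraMap ℚ L)).mulVec u) ≤
      v a ^ k * (C * D) := by
    intro k
    set P : Matrix (Fin n) (Fin n) ℚ := ratMat A ^ (-(k : ℤ)) with hP
    -- The columns of `A^{-k}` lie in `G_A`, so their images under `T` do too: the bound `C` does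
    -- not depend on `k`.
    have h1 : ∀ c, v (w ⬝ᵥ (algebraMap ℚ L ∘ ((endMatrix T * P).col c))) ≤ C := by
      intro c
      have hm : P.col c ∈ groupG A hA := by
        refine ⟨-(k : ℤ), Pi.single c 1, ?_⟩
        rw [← hP, ← Matrix.mulVec_single_one]
        congr 1
        funext i
        simp [Pi.single_apply]
      refine valuation_dotProduct_le_of_mem_groupG (hA := hA) v hb hw hC ?_
      have h2 : (endMatrix T * P).col c = (T ⟨P.col c, hm⟩ : Fin n → ℚ) := by
        rw [← endMatrix_mulVec]
        funext i
        simp [Matrix.mul_apply, Matrix.mulVec, dotProduct]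
      rw [h2]
      exact (T ⟨P.col c, hm⟩).2
    have h2 : w ⬝ᵥ ((endMatrix T).map (algebraMap ℚ L)).mulVec u = a ^ k *
        ∑ c, (w ⬝ᵥ (algebraMap ℚ L ∘ ((endMatrix T * P).col c))) * u c := by
      have h3 := Matrix.map_zpow_mulVec (isUnit_det_ratMat hA) ha0 hu (-(k : ℤ))
      have h4 : u = a ^ k • (P.map (algebraMap ℚ L)).mulVec u := by
        rw [hP, h3, smul_smul, zpow_neg, zpow_natCast, mul_inv_cancel₀ (pow_ne_zero _ ha0),
          one_smul]
      conv_lhs => rw [h4]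
      rw [Matrix.mulVec_smul, dotProduct_smul, smul_eq_mul, Matrix.mulVec_mulVec,
        ← Matrix.map_mul, Matrix.dotProduct_mulVec]
      rfl
    rw [h2, map_mul, map_pow]
    refine mul_le_mul' le_rfl (v.map_sum_le fun c _ => ?_)
    rw [map_mul]
    exact mul_le_mul' (h1 c) (hD c)
  by_contra hne
  have hne' := (v.ne_zero_iff).2 hne
  -- Needed in order to divide by `C * D` before choosing `k`.
  have hCD : C * D ≠ 0 := by
    intro h
    have := key 0
    rw [h, mul_zero] at this
    exact hne' (le_zero_iff.1 this)
  obtain ⟨k, hk⟩ := exists_pow_lt₀ ha (Units.mk0 _ hne' / Units.mk0 _ hCD)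
  refine absurd (key k) (not_le.2 ?_)
  rw [Units.val_div_eq_div_val, Units.val_mk0, Units.val_mk0] at hk
  rwa [lt_div_iff₀ (zero_lt_iff.2 hCD)] at hk

/-! ### Number fields, conjugate eigenvectors and duality -/

theorem exists_heightOneSpectrum_natCast_mem (L : Type*) [Field L] [NumberField L] {p : ℕ}
    (hp : p.Prime) : ∃ v : HeightOneSpectrum (𝓞 L), (p : 𝓞 L) ∈ v.asIdeal := by
  have hp' : Prime (p : ℤ) := Nat.prime_iff_prime_int.1 hp
  have hprime : (Ideal.span {(p : ℤ)}).IsPrime :=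
    (Ideal.span_singleton_prime hp'.ne_zero).2 hp'
  obtain ⟨P, hP, hover⟩ := Ideal.nonempty_primesOver (S := 𝓞 L) (Ideal.span {(p : ℤ)})
  have hmem : (p : 𝓞 L) ∈ P := by
    have : (p : ℤ) ∈ P.under ℤ := hover.over ▸ Ideal.mem_span_singleton_self (p : ℤ)
    simpa [Ideal.mem_comap] using this
  refine ⟨⟨P, hP, ?_⟩, hmem⟩
  rintro rfl
  exact hp.ne_zero (by simpa using hmem)

theorem algHom_ext_of_adjoin_eq_top {F K L : Type*} [Field F] [Field K] [Field L] [Algebra F K]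
    [Algebra F L] {l : K} (hK : F⟮l⟯ = ⊤) {φ ψ : K →ₐ[F] L} (h : φ l = ψ l) : φ = ψ := by
  have h1 : φ.comp (⊤ : IntermediateField F K).val = ψ.comp (⊤ : IntermediateField F K).val := by
    refine algHom_ext_of_eq_adjoin F hK.symm fun x hx => ?_
    rw [Set.mem_singleton_iff] at hx
    subst hx
    exact h
  exact AlgHom.ext fun x => DFunLike.congr_fun h1 ⟨x, trivial⟩

theorem exists_numberField_isGalois_extension.{u} (K : Type u) [Field K] [NumberField K] :
    ∃ (L : Type u) (_ : Field L) (_ : NumberField L) (_ : Algebra K L), IsGalois ℚ L := by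
  have : Algebra.IsAlgebraic ℚ (AlgebraicClosure K) := Algebra.IsAlgebraic.trans ℚ K _
  have : IsAlgClosure ℚ (AlgebraicClosure K) := ⟨inferInstance, inferInstance⟩
  have : Normal ℚ (AlgebraicClosure K) := IsAlgClosure.normal ℚ _
  have hN := normalClosure.normal ℚ K (AlgebraicClosure K)
  have : NumberField (normalClosure ℚ K (AlgebraicClosure K)) :=
    NumberField.of_module_finite ℚ _
  refine ⟨normalClosure ℚ K (AlgebraicClosure K), inferInstance, inferInstance, inferInstance, ?_⟩
  exact { to_normal := by convert! hN }

section Conjugates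

variable {K L : Type*} [Field K] [NumberField K] [Field L] [NumberField L]

theorem map_mulVec_algHom_comp {n : ℕ} (M : Matrix (Fin n) (Fin n) ℚ) (u : Fin n → K)
    (φ : K →ₐ[ℚ] L) :
    (M.map (algebraMap ℚ L)).mulVec (φ ∘ u) = φ ∘ ((M.map (algebraMap ℚ K)).mulVec u) := by
  funext i
  simp [Matrix.mulVec, dotProduct]

theorem vecMul_map_algHom_comp {n : ℕ} (M : Matrix (Fin n) (Fin n) ℚ) (u : Fin n → K)
    (φ : K →ₐ[ℚ] L) :
    Matrix.vecMul (φ ∘ u) (M.map (algebraMap ℚ L)) =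
      φ ∘ (Matrix.vecMul u (M.map (algebraMap ℚ K))) := by
  funext i
  simp [Matrix.vecMul, dotProduct]

theorem algHom_comp_smul {n : ℕ} (c : K) (u : Fin n → K) (φ : K →ₐ[ℚ] L) :
    φ ∘ (c • u) = φ c • (φ ∘ u) := by
  funext i
  simp

theorem algHom_comp_ne_zero {n : ℕ} {u : Fin n → K} (hu : u ≠ 0) (φ : K →ₐ[ℚ] L) :
    φ ∘ u ≠ 0 := by
  obtain ⟨i, hi⟩ := Function.ne_iff.1 hu
  exact Function.ne_iff.2 ⟨i, by simpa using hi⟩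

/-- The factor is a quotient of coordinates of `x` and `u`, hence already in `K`. This brings
conclusions obtained over `L` back to `K`. -/
theorem exists_eq_smul_of_algHom_comp {n : ℕ} {u x : Fin n → K} (hu0 : u ≠ 0) (φ : K →ₐ[ℚ] L)
    (h : ∃ c : L, φ ∘ x = c • (φ ∘ u)) : ∃ c : K, x = c • u := by
  obtain ⟨c, hc⟩ := h
  obtain ⟨i, hi⟩ := Function.ne_iff.1 hu0
  have hi' : φ (u i) ≠ 0 := by simpa using hi
  have h1 : ∀ j, φ (x j) = c * φ (u j) := fun j => congrFun hc j
  have h2 : c = φ (x i / u i) := by rw [map_div₀, h1, mul_div_cancel_right₀ _ hi']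
  refine ⟨x i / u i, _root_.funext fun j => φ.injective ?_⟩
  change φ (x j) = φ (x i / u i * u j)
  rw [h1, h2, map_mul]

/-- The conjugates of an eigenvector whose eigenvalue has degree `n` span the whole space. -/
theorem span_range_algHom_comp_eq_top [Algebra K L] {l : K} {n : ℕ}
    (hn : Fintype.card (K →ₐ[ℚ] L) = n)
    (hK : ℚ⟮l⟯ = ⊤) {B : Matrix (Fin n) (Fin n) ℚ} {u : Fin n → K} (hu0 : u ≠ 0)
    (hu : (B.map (algebraMap ℚ K)).mulVec u = l • u) :
    Submodule.span L (Set.range fun φ : K →ₐ[ℚ] L => φ ∘ u) = ⊤ := by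
  have : Nonempty (K →ₐ[ℚ] L) := ⟨IsScalarTower.toAlgHom ℚ K L⟩
  refine LinearIndependent.span_eq_top_of_card_eq_finrank ?_ (by simpa using hn)
  refine Module.End.eigenvectors_linearIndependent'
    (Matrix.toLin' (B.map (algebraMap ℚ L))) (fun φ : K →ₐ[ℚ] L => φ l)
    (fun φ ψ h => algHom_ext_of_adjoin_eq_top hK h) _ fun φ => ⟨?_, algHom_comp_ne_zero hu0 φ⟩
  rw [Module.End.mem_eigenspace_iff, Matrix.toLin'_apply, map_mulVec_algHom_comp, hu,
    algHom_comp_smul]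

/-- A vector orthogonal to all the conjugates but one of a left eigenvector is proportional to the
remaining conjugate of the right eigenvector. -/
theorem exists_eq_smul_of_dotProduct_eq_zero [Algebra K L] {l : K} {n : ℕ}
    (hn : Fintype.card (K →ₐ[ℚ] L) = n)
    (hK : ℚ⟮l⟯ = ⊤) {B : Matrix (Fin n) (Fin n) ℚ} {u w : Fin n → K} (hu0 : u ≠ 0) (hw0 : w ≠ 0)
    (hu : (B.map (algebraMap ℚ K)).mulVec u = l • u)
    (hw : Matrix.vecMul w (B.map (algebraMap ℚ K)) = l • w) (φ : K →ₐ[ℚ] L) {x : Fin n → L}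
    (hx : ∀ ψ : K →ₐ[ℚ] L, ψ ≠ φ → (ψ ∘ w) ⬝ᵥ x = 0) : ∃ c : L, x = c • (φ ∘ u) := by
  have hspan := span_range_algHom_comp_eq_top hn hK hu0 hu
  have horth : ∀ ψ χ : K →ₐ[ℚ] L, χ ≠ ψ → (ψ ∘ w) ⬝ᵥ (χ ∘ u) = 0 := fun ψ χ hne => by
    have h1 := Matrix.dotProduct_mulVec (ψ ∘ w) (B.map (algebraMap ℚ L)) (χ ∘ u)
    rw [map_mulVec_algHom_comp, vecMul_map_algHom_comp, hu, hw, algHom_comp_smul,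
      algHom_comp_smul, dotProduct_smul, smul_dotProduct, smul_eq_mul, smul_eq_mul] at h1
    by_contra h0
    exact hne (algHom_ext_of_adjoin_eq_top hK (mul_right_cancel₀ h0 h1))
  have hexp : ∀ y : Fin n → L, ∃ c : (K →ₐ[ℚ] L) → L, ∑ χ, c χ • (χ ∘ u) = y := fun y =>
    (Submodule.mem_span_range_iff_exists_fun L).1 (hspan ▸ Submodule.mem_top)
  have hdot : ∀ (ψ : K →ₐ[ℚ] L) (c : (K →ₐ[ℚ] L) → L),
      (ψ ∘ w) ⬝ᵥ (∑ χ, c χ • (χ ∘ u)) = c ψ * ((ψ ∘ w) ⬝ᵥ (ψ ∘ u)) := fun ψ c => by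
    rw [dotProduct_sum, Finset.sum_eq_single ψ (fun χ _ hne => by
      rw [dotProduct_smul, horth ψ χ hne, smul_zero]) (by simp), dotProduct_smul, smul_eq_mul]
  -- Otherwise `ψ ∘ w` would be orthogonal to every `χ ∘ u`, hence to the whole space.
  have hself : ∀ ψ : K →ₐ[ℚ] L, (ψ ∘ w) ⬝ᵥ (ψ ∘ u) ≠ 0 := fun ψ h0 => by
    refine algHom_comp_ne_zero hw0 ψ (dotProduct_eq_zero _ fun y => ?_)
    obtain ⟨c, rfl⟩ := hexp y
    rw [hdot, h0, mul_zero]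
  obtain ⟨c, rfl⟩ := hexp x
  refine ⟨c φ, Finset.sum_eq_single φ (fun ψ _ hne => ?_) (by simp)⟩
  have h1 := hx ψ hne
  rw [hdot] at h1
  rw [(mul_eq_zero.1 h1).resolve_right (hself ψ), zero_smul]

end Conjugates

/-! ### Embeddings of `K` and reduction modulo a prime -/

section Embeddings

variable {K L : Type*} [Field K] [NumberField K] [Field L] [NumberField L] [Algebra K L]
  [IsGalois ℚ L] {l : K} {h : ℤ[X]}

theorem minpoly_eq_map_of_irreducible (hm : h.Monic) (hirr : Irreducible h)
    (hl : aeval l h = 0) : minpoly ℚ l = h.map (Int.castRingHom ℚ) := by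
  refine (minpoly.eq_of_irreducible_of_monic
    ((hm.irreducible_iff_irreducible_map_fraction_map (K := ℚ)).1 hirr) ?_ (hm.map _)).symm
  exact (aeval_map_algebraMap ℚ l h).trans hl

theorem card_algHom_eq_natDegree (hm : h.Monic) (hirr : Irreducible h) (hl : aeval l h = 0)
    (hK : ℚ⟮l⟯ = ⊤) : Fintype.card (K →ₐ[ℚ] L) = h.natDegree := by
  rw [AlgHom.card_of_splits ℚ K L fun x => ?_, ← finrank_top', ← hK,
    adjoin.finrank (Algebra.IsIntegral.isIntegral l), minpoly_eq_map_of_irreducible hm hirr hl,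
    hm.natDegree_map]
  rw [← minpoly.algebraMap_eq (algebraMap K L).injective x]
  exact Normal.splits inferInstance _

theorem map_eq_prod_X_sub_C_algHom (hm : h.Monic) (hirr : Irreducible h) (hl : aeval l h = 0)
    (hK : ℚ⟮l⟯ = ⊤) :
    h.map (Int.castRingHom L) = ∏ φ : K →ₐ[ℚ] L, (X - C (φ l)) := by
  refine eq_of_monic_of_dvd_of_natDegree_le (monic_prod_X_sub_C _ _) (hm.map _) ?_ ?_
  · refine Fintype.prod_dvd_of_coprime
      (pairwise_coprime_X_sub_C fun φ ψ hφψ => algHom_ext_of_adjoin_eq_top hK hφψ) fun φ => ?_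
    rw [dvd_iff_isRoot, IsRoot, eval_map]
    have := congrArg φ hl
    rwa [map_zero, aeval_def, algebraMap_int_eq, ← AlgHom.coe_toRingHom, hom_eval₂,
      RingHom.ext_int (RingHom.comp _ _) (Int.castRingHom L)] at this
  · rw [natDegree_prod_of_monic _ _ fun φ _ => monic_X_sub_C _, hm.natDegree_map,
      ← card_algHom_eq_natDegree (L := L) hm hirr hl hK]
    simp

/-- Over `𝓞 L` the polynomial is the product of the `X - φ(l)`. Modulo `v`, the factors with root
`0` are those with `φ(l)` in `v`, and passing from `ZMod p` to the residue field preserves root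
multiplicities. -/
theorem card_valuation_lt_one_eq_rootMultiplicity (hm : h.Monic) (hirr : Irreducible h)
    (hl : aeval l h = 0) (hK : ℚ⟮l⟯ = ⊤) {p : ℕ} (hp : p.Prime) (v : HeightOneSpectrum (𝓞 L))
    (hv : (p : 𝓞 L) ∈ v.asIdeal) :
    (Finset.univ.filter fun φ : K →ₐ[ℚ] L => v.valuation L (φ l) < 1).card =
      (h.map (Int.castRingHom (ZMod p))).rootMultiplicity 0 := by
  classical
  have : Fact p.Prime := ⟨hp⟩
  have hint : ∀ φ : K →ₐ[ℚ] L, ∃ a : 𝓞 L, (a : L) = φ l := fun φ =>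
    ⟨⟨φ l, (show IsIntegral ℤ l from ⟨h, hm, hl⟩).map φ⟩, rfl⟩
  choose a ha using hint
  have hprod : h.map (Int.castRingHom (𝓞 L)) = ∏ φ : K →ₐ[ℚ] L, (X - C (a φ)) := by
    apply Polynomial.map_injective _ (RingOfIntegers.coe_injective (K := L))
    rw [Polynomial.map_map, RingHom.ext_int (RingHom.comp _ _) (Int.castRingHom L),
      map_eq_prod_X_sub_C_algHom hm hirr hl hK, Polynomial.map_prod]
    simp [ha]
  let k := 𝓞 L ⧸ v.asIdeal
  have hchar : CharP k p := (CharP.charP_iff_prime_eq_zero hp).2 (by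
    rw [← map_natCast (Ideal.Quotient.mk v.asIdeal)]
    exact Ideal.Quotient.eq_zero_iff_mem.2 hv)
  have hk : (h.map (Int.castRingHom (ZMod p))).map (ZMod.castHom dvd_rfl k) =
      ∏ φ : K →ₐ[ℚ] L, (X - C (Ideal.Quotient.mk v.asIdeal (a φ))) := by
    rw [Polynomial.map_map, RingHom.ext_int (RingHom.comp _ _)
      ((Ideal.Quotient.mk v.asIdeal).comp (Int.castRingHom (𝓞 L))), ← Polynomial.map_map, hprod,
      Polynomial.map_prod]
    simp
  have hroots : (∏ φ : K →ₐ[ℚ] L, (X - C (Ideal.Quotient.mk v.asIdeal (a φ)))).roots =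
      Finset.univ.val.map fun φ : K →ₐ[ℚ] L => Ideal.Quotient.mk v.asIdeal (a φ) := by
    rw [← roots_multiset_prod_X_sub_C (Multiset.map _ _), Multiset.map_map]
    rfl
  rw [eq_rootMultiplicity_map (f := ZMod.castHom dvd_rfl k) (RingHom.injective _), hk, map_zero,
    ← count_roots, hroots, Multiset.count_map, Finset.card_def, Finset.filter_val]
  congr 1
  refine Multiset.filter_congr fun φ _ => ?_
  rw [← ha, HeightOneSpectrum.valuation_lt_one_iff_mem, eq_comm, Ideal.Quotient.eq_zero_iff_mem]

/-- If the multiplicity of `0` as a root of `h` modulo `p` is coprime to the degree, then any two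
conjugates of the root `l` are separated by the reduction modulo some prime above `p`. -/
theorem exists_algEquiv_valuation_lt_one (hm : h.Monic) (hirr : Irreducible h)
    (hl : aeval l h = 0) (hK : ℚ⟮l⟯ = ⊤) {p : ℕ} (hp : p.Prime)
    (hcop : Nat.Coprime h.natDegree ((h.map (Int.castRingHom (ZMod p))).rootMultiplicity 0))
    (v : HeightOneSpectrum (𝓞 L)) (hv : (p : 𝓞 L) ∈ v.asIdeal) {φ ψ : K →ₐ[ℚ] L} (hφψ : φ ≠ ψ) :
    ∃ σ : L ≃ₐ[ℚ] L, v.valuation L (σ (φ l)) < 1 ∧ v.valuation L (σ (ψ l)) = 1 := by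
  classical
  let _ : MulAction (L ≃ₐ[ℚ] L) (K →ₐ[ℚ] L) :=
    { smul := fun σ φ => (σ : L →ₐ[ℚ] L).comp φ
      one_smul := fun φ => rfl
      mul_smul := fun σ τ φ => rfl }
  have hsmul : ∀ (σ : L ≃ₐ[ℚ] L) (φ : K →ₐ[ℚ] L) (x : K), (σ • φ) x = σ (φ x) :=
    fun _ _ _ => rfl
  -- The images `φ l` and `ψ l` share a minimal polynomial over `ℚ`, and `l` generates `K`.
  have : MulAction.IsPretransitive (L ≃ₐ[ℚ] L) (K →ₐ[ℚ] L) := ⟨fun φ ψ => by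
    obtain ⟨σ, hσ⟩ := minpoly.exists_algEquiv_of_root (K := ℚ) (x := φ l) (y := ψ l)
      (Algebra.IsAlgebraic.isAlgebraic _) (by
        rw [minpoly.algHom_eq ψ ψ.injective, ← minpoly.algHom_eq φ φ.injective, minpoly.aeval])
    exact ⟨σ, algHom_ext_of_adjoin_eq_top hK hσ⟩⟩
  obtain ⟨σ, h1, h2⟩ := exists_smul_mem_smul_notMem (G := L ≃ₐ[ℚ] L)
    (Finset.univ.filter fun φ : K →ₐ[ℚ] L => v.valuation L (φ l) < 1)
    (by rwa [card_algHom_eq_natDegree hm hirr hl hK,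
      card_valuation_lt_one_eq_rootMultiplicity hm hirr hl hK hp v hv]) hφψ
  simp only [Finset.mem_filter, Finset.mem_univ, true_and, hsmul, not_lt] at h1 h2
  refine ⟨σ, h1, le_antisymm ?_ h2⟩
  have hint : IsIntegral ℤ (σ (ψ l)) :=
    ((show IsIntegral ℤ l from ⟨h, hm, hl⟩).map ψ).map (σ : L →ₐ[ℚ] L)
  exact v.valuation_le_one (⟨σ (ψ l), hint⟩ : 𝓞 L)

end Embeddings

/-! ### Matrices of endomorphisms -/

theorem endMatrix_map_mul {n : ℕ} {A : Matrix (Fin n) (Fin n) ℤ} {hA : A.det ≠ 0}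
    (S T : EndG A hA) : endMatrix (S * T) = endMatrix S * endMatrix T := by
  ext i j
  have h := congrFun (endMatrix_mulVec S (T ⟨Pi.single j 1, single_mem_groupG A hA j⟩)) i
  exact h.symm

theorem endMatrix_map_add {n : ℕ} {A : Matrix (Fin n) (Fin n) ℤ} {hA : A.det ≠ 0}
    (S T : EndG A hA) : endMatrix (S + T) = endMatrix S + endMatrix T := rfl

theorem endMatrix_map_one {n : ℕ} {A : Matrix (Fin n) (Fin n) ℤ} {hA : A.det ≠ 0} :
    endMatrix (1 : EndG A hA) = 1 := by
  ext i j
  simp [endMatrix, Matrix.one_apply, Pi.single_apply]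

theorem eq_zero_of_endMatrix_eq_zero {n : ℕ} {A : Matrix (Fin n) (Fin n) ℤ} {hA : A.det ≠ 0}
    {T : EndG A hA} (h : endMatrix T = 0) : T = 0 := by
  refine AddMonoidHom.ext fun g => Subtype.ext ?_
  exact (endMatrix_mulVec T g).symm.trans (by rw [h, Matrix.zero_mulVec]; rfl)

/-- Some power of `A` clears the denominators of an endomorphism of `G_A`. -/
theorem exists_pow_mul_endMatrix_eq_map {n : ℕ} {A : Matrix (Fin n) (Fin n) ℤ} {hA : A.det ≠ 0}
    (T : EndG A hA) : ∃ (m : ℕ) (N : Matrix (Fin n) (Fin n) ℤ),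
      ratMat A ^ m * endMatrix T = ratMat N := by
  have h1 : ∀ j, ∃ (k : ℤ) (x : Fin n → ℤ),
      (endMatrix T).col j = (ratMat A ^ k).mulVec fun i => (x i : ℚ) := fun j =>
    (T ⟨Pi.single j 1, single_mem_groupG A hA j⟩).2
  choose k x hx using h1
  obtain ⟨m, hm⟩ : ∃ m : ℕ, ∀ j, -(m : ℤ) ≤ k j :=
    ⟨Finset.univ.sup fun j => (-k j).toNat, fun j => by
      have := Finset.le_sup (f := fun j => (-k j).toNat) (Finset.mem_univ j)
      omega⟩
  choose y hy using fun j => exists_zpow_mulVec_eq hA (hm j) (x j)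
  refine ⟨m, Matrix.of fun i j => y j i, ?_⟩
  ext i j
  have h2 : (ratMat A ^ m).mulVec ((endMatrix T).col j) = fun i => (y j i : ℚ) := by
    rw [hx, hy, Matrix.mulVec_mulVec, ← zpow_natCast,
      ← Matrix.zpow_add (isUnit_det_ratMat hA), add_neg_cancel, zpow_zero, Matrix.one_mulVec]
  exact congrFun h2 i

/-! ### Eigenvalues of endomorphisms at `u` -/

section Eigenvalue

variable {n : ℕ} {A : Matrix (Fin n) (Fin n) ℤ} {hA : A.det ≠ 0} {K : Type*} [Field K]
  [NumberField K] {l : K} {u w : Fin n → K}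

theorem map_intCast_eq_map_ratMat (A : Matrix (Fin n) (Fin n) ℤ) :
    A.map (Int.castRingHom K) = (ratMat A).map (algebraMap ℚ K) := by
  ext i j
  simp

theorem eigenvalue_ne_zero (hA : A.det ≠ 0) (hu0 : u ≠ 0)
    (hu : ((ratMat A).map (algebraMap ℚ K)).mulVec u = l • u) : l ≠ 0 := by
  rintro rfl
  rw [zero_smul] at hu
  have hdet : ((ratMat A).map (algebraMap ℚ K)).det ≠ 0 := by
    have : ((ratMat A).map (algebraMap ℚ K)).det = algebraMap ℚ K (ratMat A).det :=
      ((algebraMap ℚ K).map_det _).symm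
    rw [this, _root_.map_ne_zero]
    exact (isUnit_det_ratMat hA).ne_zero
  exact hu0 (Matrix.eq_zero_of_mulVec_eq_zero hdet hu)

theorem aeval_charpoly_eq_zero_of_hasEigenvalue
    (hl : Module.End.HasEigenvalue (Matrix.toLin' (A.map (Int.castRingHom K))) l) :
    aeval l A.charpoly = 0 := by
  rw [Module.End.hasEigenvalue_iff_isRoot_charpoly, Matrix.charpoly_toLin', Matrix.charpoly_map,
    IsRoot, eval_map] at hl
  rwa [aeval_def, algebraMap_int_eq]

theorem exists_left_eigenvector
    (hl : Module.End.HasEigenvalue (Matrix.toLin' (A.map (Int.castRingHom K))) l) :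
    ∃ w : Fin n → K, w ≠ 0 ∧ Matrix.vecMul w ((ratMat A).map (algebraMap ℚ K)) = l • w := by
  rw [Module.End.hasEigenvalue_iff_isRoot_charpoly, Matrix.charpoly_toLin',
    ← Matrix.charpoly_transpose, ← Matrix.charpoly_toLin',
    ← Module.End.hasEigenvalue_iff_isRoot_charpoly] at hl
  obtain ⟨w, hw⟩ := hl.exists_hasEigenvector
  refine ⟨w, hw.2, ?_⟩
  have := hw.apply_eq_smul
  rwa [Matrix.toLin'_apply, Matrix.mulVec_transpose, map_intCast_eq_map_ratMat] at this

theorem exists_endMatrix_mulVec_eq_smul (hirr : Irreducible A.charpoly)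
    (hcop : ∃ p : ℕ, p.Prime ∧ Nat.gcd n (tMult A p) = 1) (hK : ℚ⟮l⟯ = ⊤)
    (hl : aeval l A.charpoly = 0) (hu0 : u ≠ 0) (hw0 : w ≠ 0)
    (hu : ((ratMat A).map (algebraMap ℚ K)).mulVec u = l • u)
    (hw : Matrix.vecMul w ((ratMat A).map (algebraMap ℚ K)) = l • w) (T : EndG A hA) :
    ∃ c : K, ((endMatrix T).map (algebraMap ℚ K)).mulVec u = c • u := by
  obtain ⟨p, hp, hcop⟩ := hcop
  have hdeg : A.charpoly.natDegree = n := by simp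
  obtain ⟨L, _, _, _, _⟩ := exists_numberField_isGalois_extension K
  obtain ⟨v, hv⟩ := exists_heightOneSpectrum_natCast_mem L hp
  have hn : Fintype.card (K →ₐ[ℚ] L) = n := by
    rw [card_algHom_eq_natDegree A.charpoly_monic hirr hl hK, hdeg]
  let φ : K →ₐ[ℚ] L := IsScalarTower.toAlgHom ℚ K L
  refine exists_eq_smul_of_algHom_comp hu0 φ ?_
  refine exists_eq_smul_of_dotProduct_eq_zero hn hK hu0 hw0 hu hw φ fun ψ hψ => ?_
  obtain ⟨σ, h1, h2⟩ := exists_algEquiv_valuation_lt_one A.charpoly_monic hirr hl hK hp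
    (by rwa [hdeg]) v hv hψ.symm
  have hl0 := eigenvalue_ne_zero hA hu0 hu
  have h3 := dotProduct_endMatrix_mulVec_eq_zero (v.valuation L)
    (u := ((σ : L →ₐ[ℚ] L).comp φ) ∘ u) (w := ((σ : L →ₐ[ℚ] L).comp ψ) ∘ w)
    (by simpa using hl0) h1 h2
    (by rw [map_mulVec_algHom_comp, hu, algHom_comp_smul]; rfl)
    (by rw [vecMul_map_algHom_comp, hw, algHom_comp_smul]; rfl) T
  rw [map_mulVec_algHom_comp] at h3
  -- Since `endMatrix T` is rational, the pairing of the `σ`-translates is `σ` of the pairing of `ψ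
  -- ∘ w` with `T (φ ∘ u)`.
  apply σ.injective
  rw [map_zero, ← h3]
  simp [dotProduct]

/-- The conjugates of `l` are distinct, so `x` is orthogonal to every other conjugate of `w`. It
lets a scalar found at one eigenvector serve all of them. -/
theorem exists_eq_smul_of_mulVec_eq_smul (hirr : Irreducible A.charpoly) (hK : ℚ⟮l⟯ = ⊤)
    (hl : aeval l A.charpoly = 0) (hu0 : u ≠ 0) (hw0 : w ≠ 0)
    (hu : ((ratMat A).map (algebraMap ℚ K)).mulVec u = l • u)
    (hw : Matrix.vecMul w ((ratMat A).map (algebraMap ℚ K)) = l • w) {x : Fin n → K}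
    (hx : ((ratMat A).map (algebraMap ℚ K)).mulVec x = l • x) :
    ∃ c : K, x = c • u := by
  obtain ⟨L, _, _, _, _⟩ := exists_numberField_isGalois_extension K
  have hn : Fintype.card (K →ₐ[ℚ] L) = n := by
    rw [card_algHom_eq_natDegree A.charpoly_monic hirr hl hK]
    simp
  let φ : K →ₐ[ℚ] L := IsScalarTower.toAlgHom ℚ K L
  refine exists_eq_smul_of_algHom_comp hu0 φ ?_
  refine exists_eq_smul_of_dotProduct_eq_zero hn hK hu0 hw0 hu hw φ fun ψ hψ => ?_
  have h1 := Matrix.dotProduct_mulVec (ψ ∘ w) ((ratMat A).map (algebraMap ℚ L)) (φ ∘ x)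
  rw [map_mulVec_algHom_comp, vecMul_map_algHom_comp, hx, hw, algHom_comp_smul,
    algHom_comp_smul, dotProduct_smul, smul_dotProduct, smul_eq_mul, smul_eq_mul] at h1
  by_contra h0
  exact hψ (algHom_ext_of_adjoin_eq_top hK (mul_right_cancel₀ h0 h1)).symm

/-- A rational matrix killing `u` kills all its conjugates, and these span. This gives the
injectivity of `ι`. -/
theorem eq_zero_of_map_mulVec_eq_zero (hirr : Irreducible A.charpoly) (hK : ℚ⟮l⟯ = ⊤)
    (hl : aeval l A.charpoly = 0) (hu0 : u ≠ 0)
    (hu : ((ratMat A).map (algebraMap ℚ K)).mulVec u = l • u) {M : Matrix (Fin n) (Fin n) ℚ}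
    (hM : (M.map (algebraMap ℚ K)).mulVec u = 0) : M = 0 := by
  obtain ⟨L, _, _, _, _⟩ := exists_numberField_isGalois_extension K
  have hn : Fintype.card (K →ₐ[ℚ] L) = n := by
    rw [card_algHom_eq_natDegree A.charpoly_monic hirr hl hK]
    simp
  have h1 : Matrix.toLin' (M.map (algebraMap ℚ L)) = 0 := by
    refine LinearMap.ext_on_range (span_range_algHom_comp_eq_top hn hK hu0 hu) fun φ => ?_
    rw [Matrix.toLin'_apply, map_mulVec_algHom_comp, hM]
    funext i
    simp
  have h2 := (LinearEquiv.map_eq_zero_iff _).1 h1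
  ext i j
  simpa using congrFun (congrFun h2 i) j

/-- An eigenvalue of an endomorphism of `G_A` at an eigenvector of `A` with eigenvalue `l` lies in
`𝒪_K[l⁻¹]`. -/
theorem mem_ringOKl_of_mulVec_eq_smul (hu0 : u ≠ 0)
    (hu : ((ratMat A).map (algebraMap ℚ K)).mulVec u = l • u) {T : EndG A hA} {c : K}
    (hc : ((endMatrix T).map (algebraMap ℚ K)).mulVec u = c • u) : c ∈ ringOKl K l := by
  obtain ⟨m, N, hN⟩ := exists_pow_mul_endMatrix_eq_map T
  have hl0 := eigenvalue_ne_zero hA hu0 hu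
  have h1 : (N.map (Int.castRingHom K)).mulVec u = (c * l ^ m) • u := by
    rw [map_intCast_eq_map_ratMat, ← hN, Matrix.map_mul, ← Matrix.mulVec_mulVec, hc,
      Matrix.mulVec_smul, Matrix.map_pow, Matrix.pow_mulVec_of_mulVec_eq_smul hu, smul_smul]
  -- `c * l ^ m` is an eigenvalue of the integer matrix `N`, hence a root of its monic
  -- characteristic polynomial.
  have h2 : IsIntegral ℤ (c * l ^ m) :=
    ⟨N.charpoly, N.charpoly_monic, aeval_charpoly_eq_zero_of_hasEigenvalue
      (Module.End.hasEigenvalue_of_hasEigenvector (x := u)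
        ⟨Module.End.mem_eigenspace_iff.2 (by rw [Matrix.toLin'_apply, h1]), hu0⟩)⟩
  have h3 : c = algebraMap (𝓞 K) K ⟨c * l ^ m, h2⟩ * l⁻¹ ^ m := by
    change c = c * l ^ m * l⁻¹ ^ m
    rw [inv_pow, mul_inv_cancel_right₀ (pow_ne_zero m hl0)]
  rw [h3]
  exact mul_mem (Subalgebra.algebraMap_mem _ _)
    (pow_mem (Algebra.subset_adjoin (Set.mem_singleton _)) m)

theorem valuation_le_one_of_mem_ringOKl (hl : IsIntegral ℤ l)
    {v : HeightOneSpectrum (𝓞 K)} (hv : v ∉ primesDividing K l) {c : K} (hc : c ∈ ringOKl K l) :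
    v.valuation K c ≤ 1 := by
  let a : 𝓞 K := ⟨l, hl⟩
  have h1 : v.valuation K l = 1 := by
    refine le_antisymm (v.valuation_le_one a) (not_lt.1 fun h => hv ⟨a, rfl, ?_⟩)
    exact (v.valuation_lt_one_iff_mem a).1 h
  induction hc using Algebra.adjoin_induction with
  | mem x hx =>
    rw [Set.mem_singleton_iff.1 hx, map_inv₀, h1, inv_one]
  | algebraMap r => exact v.valuation_le_one r
  | add x y _ _ hx hy => exact (v.valuation K).map_add_le hx hy
  | mul x y _ _ hx hy =>
    rw [map_mul]
    exact mul_le_one' hx hy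

end Eigenvalue

/-! ### The embedding of the endomorphism ring -/

theorem mainTheorem1 (n : ℕ) (A : Matrix (Fin n) (Fin n) ℤ) (hA : A.det ≠ 0)
    (hirr : Irreducible A.charpoly) (hP' : (primesP' A).Nonempty)
    (hcop : ∃ p : ℕ, p.Prime ∧ Nat.gcd n (tMult A p) = 1)
    (K : Type*) [Field K] [NumberField K] (l : K) (hK : ℚ⟮l⟯ = ⊤)
    (hl : Module.End.HasEigenvalue (Matrix.toLin' (A.map (Int.castRingHom K))) l) :
    ∃ ι : EndG A hA →+* ringOKl K l,
      Function.Injective ι ∧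
      (∀ u : Fin n → K,
        Module.End.HasEigenvector (Matrix.toLin' (A.map (Int.castRingHom K))) l u →
        ∀ T : EndG A hA,
          ((endMatrix T).map (algebraMap ℚ K)).mulVec u = (ι T : K) • u ∧
          (T ≠ 0 →
            (Submodule.span K {u}).map
              (Matrix.toLin' ((endMatrix T).map (algebraMap ℚ K))) =
            Submodule.span K {u})) ∧
      ∃ j : AutG A hA →* (primesDividing K l).unit K,
        Function.Injective j ∧
        ∀ T : AutG A hA, ((j T : Kˣ) : K) = (ι (T : EndG A hA) : K) := by
  have haev := aeval_charpoly_eq_zero_of_hasEigenvalue hl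
  have hint : IsIntegral ℤ l := ⟨A.charpoly, A.charpoly_monic, haev⟩
  obtain ⟨u, hu'⟩ := hl.exists_hasEigenvector
  have hu0 : u ≠ 0 := hu'.2
  have heig : ∀ {x : Fin n → K},
      Module.End.HasEigenvector (Matrix.toLin' (A.map (Int.castRingHom K))) l x →
      ((ratMat A).map (algebraMap ℚ K)).mulVec x = l • x := fun h => by
    rw [← map_intCast_eq_map_ratMat, ← Matrix.toLin'_apply, h.apply_eq_smul]
  have hu := heig hu'
  obtain ⟨w, hw0, hw⟩ := exists_left_eigenvector hl
  choose c hc using exists_endMatrix_mulVec_eq_smul (hA := hA) hirr hcop hK haev hu0 hw0 hu hw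
  have huniq : ∀ {a : K} {T : EndG A hA},
      ((endMatrix T).map (algebraMap ℚ K)).mulVec u = a • u → c T = a := fun {a T} h =>
    smul_left_injective K hu0 ((hc T).symm.trans h)
  have hadd : ∀ S T, c (S + T) = c S + c T := fun S T => huniq (by
    rw [endMatrix_map_add, Matrix.map_add _ (map_add _), Matrix.add_mulVec, hc, hc, add_smul])
  have hmul : ∀ S T, c (S * T) = c S * c T := fun S T => huniq (by
    rw [endMatrix_map_mul, Matrix.map_mul, ← Matrix.mulVec_mulVec, hc, Matrix.mulVec_smul, hc,
      smul_smul, mul_comm])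
  have hone : c 1 = 1 := huniq (by
    rw [endMatrix_map_one, Matrix.map_one _ (map_zero _) (map_one _), Matrix.one_mulVec, one_smul])
  have hzero : c 0 = 0 := by simpa using hadd 0 0
  have hmem : ∀ T, c T ∈ ringOKl K l := fun T => mem_ringOKl_of_mulVec_eq_smul hu0 hu (hc T)
  have hker : ∀ T, c T = 0 → T = 0 := fun T h => by
    refine eq_zero_of_endMatrix_eq_zero (eq_zero_of_map_mulVec_eq_zero hirr hK haev hu0 hu ?_)
    rw [hc, h, zero_smul]
  let ι : EndG A hA →+* ringOKl K l :=
    { toFun := fun T => ⟨c T, hmem T⟩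
      map_one' := Subtype.ext hone
      map_mul' := fun S T => Subtype.ext (hmul S T)
      map_zero' := Subtype.ext hzero
      map_add' := fun S T => Subtype.ext (hadd S T) }
  have hι : ∀ T, (ι T : K) = c T := fun T => rfl
  have hinj : Function.Injective ι :=
    (injective_iff_map_eq_zero ι).2 fun T h => hker T (congrArg Subtype.val h)
  refine ⟨ι, hinj, fun x hx T => ?_, ?_⟩
  · have hTx : ((endMatrix T).map (algebraMap ℚ K)).mulVec x = (ι T : K) • x := by
      obtain ⟨d, rfl⟩ := exists_eq_smul_of_mulVec_eq_smul hirr hK haev hu0 hw0 hu hw (heig hx)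
      rw [Matrix.mulVec_smul, hc, smul_comm, hι]
    refine ⟨hTx, fun hT => ?_⟩
    rw [Submodule.map_span, Set.image_singleton, Matrix.toLin'_apply, hTx]
    exact Submodule.span_singleton_smul_eq (isUnit_iff_ne_zero.2 fun h => hT (hker T h)) x
  · let f : EndG A hA →* K := ((ringOKl K l).val : ringOKl K l →* K).comp ι
    -- Outside `𝒮_λ` the eigenvalues of `T` and `T⁻¹` both have valuation at most `1` and their
    -- product is `1`, so both valuations equal `1`.
    have hval : ∀ T : AutG A hA, Units.map f T ∈ (primesDividing K l).unit K := fun T v hv => by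
      refine le_antisymm (valuation_le_one_of_mem_ringOKl hint hv (hmem T)) ?_
      have h1 := valuation_le_one_of_mem_ringOKl hint hv (hmem (T⁻¹ : AutG A hA))
      have h2 : c T * c (T⁻¹ : AutG A hA) = 1 := by
        rw [← hmul, Units.mul_inv, hone]
      have h3 := congrArg (v.valuation K) h2
      rw [map_mul, map_one] at h3
      rw [← h3]
      exact mul_le_of_le_one_right' h1
    refine ⟨(Units.map f).codRestrict _ hval, fun S T h => Units.ext (hinj (Subtype.ext ?_)),
      fun T => rfl⟩
    exact congrArg (fun y : (primesDividing K l).unit K => ((y : Kˣ) : K)) h
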